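/- Let $\mathbb{F}$ be $\mathbb{R}$ or $\mathbb{C}$, let $A,B,C\in\mathbb{F}^{m\times m}$, and let $P$ be an $m\times m$ permutation matrix (any one of the $m!$ matrices $P_k$, $1\le k\le m!$). Put $f^{(P)}(X)=PXP^\top$ and $f^{(R)}(X)=PX^\top P^\top$ for $X\in\mathbb{F}^{m\times m}$. For a square matrix $M$ let $\sigma(M)\subset\mathbb{C}$ be the set of its complex eigenvalues. For a matrix pencil $E-\lambda F$ let $\sigma(E-\lambda F)\subset\mathbb{C}\cup\{\infty\}$ consist of all $\lambda\in\mathbb{C}$ with $\det(E-\lambda F)=0$, together with $\infty$ if $\det F=0$. Two elements of $\mathbb{C}\cup\{\infty\}$ are called reciprocals of each other if both are finite with product $1$, or if one is $0$ and the other is $\infty$. (a) The equation $AX+f^{(P)}(X)B=C$ has exactly one solution $X\in\mathbb{F}^{m\times m}$ if and only if $$\sigma(P^\top A)\cap\sigma(-P^\top B)=\emptyset .$$ (b) The equation $AX+f^{(R)}(X)B=C$ has exactly one solution $X\in\mathbb{F}^{m\times m}$ if and only if the following two conditions hold: (1) no two elements $\lambda_1,\lambda_2$, equal or distinct, of $\sigma(P^\top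 A-\lambda B^\top P)\setminus\{1\}$ are reciprocals of each other; (2) if $1\in\sigma(P^\top A-\lambda B^\top P)$, then $1$ is a simple eigenvalue of the pencil, i.e. a root of multiplicity exactly one of the polynomial $\det(P^\top A-\lambda B^\top P)$ in $\lambda$. -/

import Mathlib

open scoped Matrix

namespace SylvesterLike

noncomputable section

variable {𝕜 : Type*} [RCLike 𝕜] {m : ℕ}

/-- The permutation matrix `P` whose `i`-th row is the unit row vector `e_{σ i}ᵀ`. -/
abbrev permMat (𝕜 : Type*) [RCLike 𝕜] (σ : Equiv.Perm (Fin m)) : Matrix (Fin m) (Fin m) 𝕜 :=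
  σ.permMatrix 𝕜

/-- The operator `f^{(P)}(X) = P X Pᵀ`. -/
def opP (σ : Equiv.Perm (Fin m)) (X : Matrix (Fin m) (Fin m) 𝕜) : Matrix (Fin m) (Fin m) 𝕜 :=
  permMat 𝕜 σ * X * (permMat 𝕜 σ)ᵀ

/-- The operator `f^{(R)}(X) = P Xᵀ Pᵀ`. -/
def opR (σ : Equiv.Perm (Fin m)) (X : Matrix (Fin m) (Fin m) 𝕜) : Matrix (Fin m) (Fin m) 𝕜 :=
  permMat 𝕜 σ * Xᵀ * (permMat 𝕜 σ)ᵀ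

/-- The equation `A X + f(X) B = C` has exactly one solution `X`. -/
def UniquelySolvable (f : Matrix (Fin m) (Fin m) 𝕜 → Matrix (Fin m) (Fin m) 𝕜)
    (A B C : Matrix (Fin m) (Fin m) 𝕜) : Prop :=
  ∃! X : Matrix (Fin m) (Fin m) 𝕜, A * X + f X * B = C

/-- A real or complex matrix regarded as a complex matrix. -/
def toComplex (M : Matrix (Fin m) (Fin m) 𝕜) : Matrix (Fin m) (Fin m) ℂ :=
  M.map (RCLike.map 𝕜 ℂ)

/-- The set of all complex eigenvalues of a real or complex matrix. -/
def eigenvalues (M : Matrix (Fin m) (Fin m) 𝕜) : Set ℂ :=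
  spectrum ℂ (toComplex M)

/-- The spectrum in `ℂ ∪ {∞}` of the matrix pencil `E - λ F`: a complex number `z` belongs to it
when `det (E - z F) = 0`, and `∞` belongs to it when `0` is an eigenvalue of the reversed pencil
`λ E - F`, that is, when `det F = 0`. (So it is everything when the pencil is singular.) -/
def pencilSpectrum (E F : Matrix (Fin m) (Fin m) 𝕜) : Set (OnePoint ℂ) :=
  {w | (∃ z : ℂ, w = (z : OnePoint ℂ) ∧ (toComplex E - z • toComplex F).det = 0) ∨
    (w = OnePoint.infty ∧ (toComplex F).det = 0)}

/-- The polynomial `det (E - λ F)` in the variable `λ`. -/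
def pencilDet (E F : Matrix (Fin m) (Fin m) 𝕜) : Polynomial ℂ :=
  ((toComplex E).map Polynomial.C
    - (Polynomial.X : Polynomial ℂ) • (toComplex F).map Polynomial.C).det

/-- The algebraic multiplicity of a finite eigenvalue `z` of the pencil `E - λ F` is one. -/
def IsSimpleEigenvalue (E F : Matrix (Fin m) (Fin m) 𝕜) (z : ℂ) : Prop :=
  (pencilDet E F).rootMultiplicity z = 1

/-- Two points of `ℂ ∪ {∞}` are reciprocals: either both are finite with product `1`, or one is `0`
and the other is `∞`. -/
def AreReciprocal (w₁ w₂ : OnePoint ℂ) : Prop :=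
  (∃ z₁ z₂ : ℂ, w₁ = (z₁ : OnePoint ℂ) ∧ w₂ = (z₂ : OnePoint ℂ) ∧ z₁ * z₂ = 1) ∨
    (w₁ = ((0 : ℂ) : OnePoint ℂ) ∧ w₂ = OnePoint.infty) ∨
    (w₁ = OnePoint.infty ∧ w₂ = ((0 : ℂ) : OnePoint ℂ))

end

end SylvesterLike

namespace SylvesterLike

open Matrix Polynomial

section Field

variable {K n : Type*} [Field K] [Fintype n]

/-! Both equations are linear in `X`, so unique solvability means trivial kernel, whatever `C` is.
Multiplying by `Pᵀ` turns the homogeneous equations into `M X - X N = 0` and `M X + (F X)ᵀ = 0`, and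
triviality of these kernels may be tested over `ℂ`.

The first is the classical Sylvester criterion. For the second, necessity comes from explicit
solutions of rank at most two, built from eigenvectors for reciprocal eigenvalues or from a Jordan
chain at `1` (`eq_zero_of_reciprocal_pair`, `sub_mulVec_ne_of_sub_mulVec_eq_zero`).

For sufficiency no Kronecker form is needed (`tSylvesterInjective_of_spectrum`). A nonzero solution
is diagonalized by equivalence. Its support cuts out a block of the transformed pencil whose
determinant divides the whole one and whose nonzero roots are closed under inversion. The spectral
conditions leave `1` as the block's only root, and the block has size at least two, so `1` is a
multiple root. -/

/-- The homogeneous equation `M X - X N = 0` has only the trivial solution. -/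
def SylvesterInjective (M N : Matrix n n K) : Prop :=
  ∀ X : Matrix n n K, M * X - X * N = 0 → X = 0

/-- The homogeneous equation `M X + (F X)ᵀ = 0` has only the trivial solution. -/
def TSylvesterInjective (M F : Matrix n n K) : Prop :=
  ∀ X : Matrix n n K, M * X + (F * X)ᵀ = 0 → X = 0

theorem aeval_mul_eq_mul_aeval_of_mul_eq [DecidableEq n] 
    {M N X : Matrix n n K} (h : M * X = X * N) (p : K[X]) :
    aeval M p * X = X * aeval N p := by
  induction p using Polynomial.induction_on' with
  | add p q hp hq => simp only [map_add, add_mul, mul_add, hp, hq]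
  | monomial k a =>
    have hk : M ^ k * X = X * N ^ k := by
      induction k with
      | zero => simp
      | succ k ih => rw [pow_succ', Matrix.mul_assoc, ih, ← Matrix.mul_assoc, h, Matrix.mul_assoc,
          pow_succ']
    simp only [aeval_monomial, Algebra.algebraMap_eq_smul_one, smul_mul_assoc, one_mul,
      mul_smul_comm, hk]

theorem mem_spectrum_iff_det_sub_smul_eq_zero [DecidableEq n] {M : Matrix n n K} {z : K} :
    z ∈ spectrum K M ↔ (M - z • 1).det = 0 := by
  rw [spectrum.mem_iff, Matrix.isUnit_iff_isUnit_det, isUnit_iff_ne_zero, not_not,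
    ← neg_sub, Matrix.det_neg, Algebra.algebraMap_eq_smul_one]
  simp

/-! ### The classical Sylvester equation -/

/-- A common eigenvalue gives the rank-one solution `v wᵀ` from a right eigenvector of `M` and a
left eigenvector of `N`. Conversely, Cayley–Hamilton gives `X * χ_M(N) = 0`, and `χ_M(N)` is
invertible by spectral mapping when the spectra are disjoint. -/
theorem sylvesterInjective_iff [DecidableEq n] [IsAlgClosed K] (M N : Matrix n n K) :
    SylvesterInjective M N ↔ spectrum K M ∩ spectrum K N = ∅ := by
  constructor
  · intro h
    rw [Set.eq_empty_iff_forall_notMem]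
    rintro z ⟨hM, hN⟩
    rw [mem_spectrum_iff_det_sub_smul_eq_zero] at hM hN
    obtain ⟨v, hv, hMv⟩ := exists_mulVec_eq_zero_iff.mpr hM
    obtain ⟨w, hw, hNw⟩ := exists_vecMul_eq_zero_iff.mpr hN
    have hX := h (vecMulVec v w) (by
      have h1 : M *ᵥ v = z • v := by
        simpa [sub_mulVec, smul_mulVec, sub_eq_zero] using hMv
      have h2 : w ᵥ* N = z • w := by
        simpa [vecMul_sub, vecMul_smul, sub_eq_zero] using hNw
      rw [mul_vecMulVec, vecMulVec_mul, h1, h2, smul_vecMulVec, vecMulVec_smul, sub_self])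
    rcases vecMulVec_eq_zero.mp hX with h | h
    · exact hv h
    · exact hw h
  · intro h X hX
    have hc := aeval_mul_eq_mul_aeval_of_mul_eq (sub_eq_zero.mp hX) M.charpoly
    rw [aeval_self_charpoly, zero_mul] at hc
    have hu : IsUnit (aeval N M.charpoly) := by
      rw [← spectrum.zero_notMem_iff K]
      intro h0
      cases isEmpty_or_nonempty n
      · simp [spectrum.of_subsingleton] at h0
      rw [spectrum.map_polynomial_aeval_of_nonempty N _
        (spectrum.nonempty_of_isAlgClosed_of_finiteDimensional K N)] at h0
      obtain ⟨z, hz, hz0⟩ := h0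
      have : z ∈ spectrum K M := mem_spectrum_iff_isRoot_charpoly.mpr hz0
      exact (Set.eq_empty_iff_forall_notMem.mp h z) ⟨this, hz⟩
    exact (hu.mul_left_eq_zero.mp hc.symm)

theorem TSylvesterInjective.congr [DecidableEq n] {M F : Matrix n n K} (h : TSylvesterInjective M F)
    {U V : Matrix n n K} (hU : IsUnit U) (hV : IsUnit V) :
    TSylvesterInjective (U * M * V) (U * F * V) := by
  intro Y hY
  obtain ⟨U', hU'⟩ := hU.exists_left_inv
  have key : V * Y * U'ᵀ = 0 := by
    apply h
    have : U' * (U * M * V * Y + (U * F * V * Y)ᵀ) * U'ᵀ = 0 := by rw [hY]; simp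
    have hT : Uᵀ * U'ᵀ = 1 := by rw [← transpose_mul, hU', transpose_one]
    rw [← this, mul_add, add_mul]
    simp only [transpose_mul, transpose_transpose, Matrix.mul_assoc, hT, Matrix.mul_one]
    simp only [← Matrix.mul_assoc, hU', Matrix.one_mul]
  have hu : IsUnit U'ᵀ := by
    refine IsUnit.of_mul_eq_one_right Uᵀ ?_
    rw [← transpose_mul, hU', transpose_one]
  exact hV.mul_right_eq_zero.mp (hu.mul_left_eq_zero.mp key)

/-! ### Necessity: low-rank solutions of `M X + (F X)ᵀ = 0` -/

namespace TSylvesterInjective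

variable {M F : Matrix n n K}

theorem eq_zero_of_mulVec_eq_zero (h : TSylvesterInjective M F) {x : n → K}
    (hM : M *ᵥ x = 0) (hF : F *ᵥ x = 0) : x = 0 := by
  have := h (vecMulVec x x) (by simp [mul_vecMulVec, hM, hF])
  simpa using this

/-- The matrix `x vᵀ - y uᵀ` solves the equation. Homogeneous coordinates `(b : a)` and `(a : b)`
for the two eigenvalues cover the pair `0, ∞` and a repeated eigenvalue `1` uniformly. -/
theorem eq_zero_of_reciprocal_pair (h : TSylvesterInjective M F) {x y u v : n → K} {a b : K}
    (hxy : LinearIndependent K ![x, y]) (hMx : M *ᵥ x = b • u) (hFx : F *ᵥ x = a • u)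
    (hMy : M *ᵥ y = a • v) (hFy : F *ᵥ y = b • v) : u = 0 ∧ v = 0 := by
  have hX := h (vecMulVec x v - vecMulVec y u) (by
    rw [mul_sub, mul_sub, mul_vecMulVec, mul_vecMulVec, mul_vecMulVec, mul_vecMulVec,
      hMx, hMy, hFx, hFy, transpose_sub, transpose_vecMulVec, transpose_vecMulVec]
    simp [smul_vecMulVec, vecMulVec_smul])
  rw [LinearIndependent.pair_iff] at hxy
  have key (j : n) : v j = 0 ∧ -u j = 0 := hxy _ _ (by
    ext i
    have := congrFun (congrFun hX i) j
    simp only [Matrix.sub_apply, vecMulVec_apply, Matrix.zero_apply] at this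
    simp only [Pi.add_apply, Pi.smul_apply, smul_eq_mul, Pi.zero_apply]
    linear_combination this)
  exact ⟨funext fun j => neg_eq_zero.mp (key j).2, funext fun j => (key j).1⟩

theorem not_det_eq_zero_and [DecidableEq n] (h : TSylvesterInjective M F) :
    ¬(M.det = 0 ∧ F.det = 0) := by
  rintro ⟨hM, hF⟩
  obtain ⟨x, hx, hMx⟩ := exists_mulVec_eq_zero_iff.mpr hM
  obtain ⟨y, hy, hFy⟩ := exists_mulVec_eq_zero_iff.mpr hF
  have hxy : LinearIndependent K ![x, y] := by
    rw [LinearIndependent.pair_iff]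
    intro s t hst
    have h1 : t • M *ᵥ y = 0 := by simpa [mulVec_add, mulVec_smul, hMx] using congrArg (M *ᵥ ·) hst
    have h2 : s • F *ᵥ x = 0 := by simpa [mulVec_add, mulVec_smul, hFy] using congrArg (F *ᵥ ·) hst
    exact ⟨(smul_eq_zero.mp h2).resolve_right fun h0 => hx (h.eq_zero_of_mulVec_eq_zero hMx h0),
      (smul_eq_zero.mp h1).resolve_right fun h0 => hy (h.eq_zero_of_mulVec_eq_zero h0 hFy)⟩
  have := (h.eq_zero_of_reciprocal_pair (a := 1) (b := 0) (u := F *ᵥ x) (v := M *ᵥ y) hxy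
    (by simpa) (by simp) (by simp) (by simpa)).1
  exact hx (h.eq_zero_of_mulVec_eq_zero hMx this)

theorem not_reciprocal_eigenvalues [DecidableEq n] (h : TSylvesterInjective M F) {a b : K}
    (ha : a ≠ 1) (hab : a * b = 1) (hMa : (M - a • F).det = 0) : (M - b • F).det ≠ 0 := by
  intro hMb
  obtain ⟨x, hx, hMx⟩ := exists_mulVec_eq_zero_iff.mpr hMa
  obtain ⟨y, hy, hMy⟩ := exists_mulVec_eq_zero_iff.mpr hMb
  rw [sub_mulVec, smul_mulVec, sub_eq_zero] at hMx hMy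
  have hFx : F *ᵥ x ≠ 0 := fun h0 => hx (h.eq_zero_of_mulVec_eq_zero (by simp [hMx, h0]) h0)
  have hFy : F *ᵥ y ≠ 0 := fun h0 => hy (h.eq_zero_of_mulVec_eq_zero (by simp [hMy, h0]) h0)
  by_cases hne : a = b
  · subst hne
    have : a = -1 := ((mul_self_eq_one_iff).mp hab).resolve_left ha
    -- At the self-reciprocal eigenvalue `-1` one eigenvector suffices: `M X = -(F x)(F x)ᵀ` is
    -- minus a symmetric matrix equal to `F X`.
    have hX := h (vecMulVec x (F *ᵥ x)) (by
      simp [mul_vecMulVec, hMx, this])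
    rcases vecMulVec_eq_zero.mp hX with h0 | h0
    · exact hx h0
    · exact hFx h0
  · have hxy : LinearIndependent K ![x, y] := by
      rw [LinearIndependent.pair_iff]
      intro s t hst
      have h1 : (t * (b - a)) • F *ᵥ y = 0 := by
        have := congrArg ((M - a • F) *ᵥ ·) hst
        simp only [mulVec_add, mulVec_smul, sub_mulVec, smul_mulVec, hMx, hMy, sub_self,
          smul_zero, zero_add, mulVec_zero, ← sub_smul] at this
        rwa [smul_smul] at this
      have ht : t = 0 := by
        rcases mul_eq_zero.mp ((smul_eq_zero.mp h1).resolve_right hFy) with h0 | h0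
        · exact h0
        · exact absurd (sub_eq_zero.mp h0).symm hne
      refine ⟨?_, ht⟩
      rw [ht, zero_smul, add_zero] at hst
      exact (smul_eq_zero.mp hst).resolve_right hx
    exact hFx (h.eq_zero_of_reciprocal_pair (a := 1) (b := a) (u := F *ᵥ x) (v := b • F *ᵥ y) hxy
      hMx (by simp) (by simp [hMy]) (by rw [smul_smul, hab, one_smul])).1

theorem not_linearIndependent_of_sub_mulVec_eq_zero (h : TSylvesterInjective M F) {x y : n → K}
    (hx : (M - F) *ᵥ x = 0) (hy : (M - F) *ᵥ y = 0) : ¬LinearIndependent K ![x, y] := by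
  intro hxy
  rw [sub_mulVec, sub_eq_zero] at hx hy
  have h0 := (h.eq_zero_of_reciprocal_pair (a := 1) (b := 1) (u := F *ᵥ x) (v := F *ᵥ y) hxy
    (by simpa) (by simp) (by simpa) (by simp)).1
  exact hxy.ne_zero 0 (h.eq_zero_of_mulVec_eq_zero (hx.trans h0) h0)

/-- Excludes a Jordan chain `x, y` of length two at the eigenvalue `1`. -/
theorem sub_mulVec_ne_of_sub_mulVec_eq_zero (h : TSylvesterInjective M F) {x : n → K} (hx : x ≠ 0)
    (hMx : (M - F) *ᵥ x = 0) (y : n → K) : (M - F) *ᵥ y ≠ F *ᵥ x := by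
  intro hy
  rw [sub_mulVec, sub_eq_zero] at hMx
  rw [sub_mulVec, sub_eq_iff_eq_add] at hy
  have hFx : F *ᵥ x ≠ 0 := fun h0 => hx (h.eq_zero_of_mulVec_eq_zero (hMx.trans h0) h0)
  -- With `u = F x` and `w = F y`, this `X` has `F X = 2(u wᵀ - w uᵀ) + u uᵀ` and `M X = 2(u wᵀ - w
  -- uᵀ) - u uᵀ`, so `M X = -(F X)ᵀ`.
  have hX := h (vecMulVec x ((2 : K) • F *ᵥ y + F *ᵥ x) - (2 : K) • vecMulVec y (F *ᵥ x)) (by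
    rw [mul_sub, mul_sub, mul_smul_comm, mul_smul_comm, mul_vecMulVec, mul_vecMulVec,
      mul_vecMulVec, mul_vecMulVec, hMx, hy]
    ext i j
    simp only [Matrix.add_apply, Matrix.sub_apply, transpose_apply, Matrix.smul_apply,
      vecMulVec_apply, Pi.add_apply, Pi.smul_apply, smul_eq_mul, Matrix.zero_apply]
    ring)
  have hxy : LinearIndependent K ![x, y] := by
    rw [LinearIndependent.pair_iff]
    intro s t hst
    have h1 : t • F *ᵥ x = 0 := by
      have := congrArg ((M - F) *ᵥ ·) hst
      simpa [mulVec_add, mulVec_smul, sub_mulVec, hMx, hy] using this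
    have ht : t = 0 := (smul_eq_zero.mp h1).resolve_right hFx
    refine ⟨?_, ht⟩
    rw [ht, zero_smul, add_zero] at hst
    exact (smul_eq_zero.mp hst).resolve_right hx
  rw [LinearIndependent.pair_iff] at hxy
  have key (j : n) := hxy (((2 : K) • F *ᵥ y + F *ᵥ x) j) (-2 * (F *ᵥ x) j) (by
    ext i
    have := congrFun (congrFun hX i) j
    simp only [Matrix.sub_apply, Matrix.smul_apply, vecMulVec_apply, Matrix.zero_apply,
      smul_eq_mul] at this
    simp only [Pi.add_apply _ _ i, Pi.smul_apply _ _ i, smul_eq_mul, Pi.zero_apply]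
    linear_combination this)
  refine hFx (funext fun j => ?_)
  by_cases h2 : (2 : K) = 0
  · simpa [h2] using (key j).1
  · simpa [h2] using (key j).2

end TSylvesterInjective

end Field

/-! ### The determinant of a pencil and simplicity of the root `1` -/

section Pencil

theorem linearIndependent_pair_single {K n : Type*} [Field K] [DecidableEq n] {i k : n}
    (hik : i ≠ k) :
    LinearIndependent K ![(Pi.single i 1 : n → K), Pi.single k 1] := by
  rw [LinearIndependent.pair_iff]
  intro s t h
  have h1 := congrFun h i
  have h2 := congrFun h k
  simp [hik, hik.symm] at h1 h2
  exact ⟨h1, h2⟩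

variable {K n : Type*} [Field K] [Fintype n] [DecidableEq n]

/-- The polynomial `det (M - λ F)` in the variable `λ`. -/
noncomputable def pencilPoly (M F : Matrix n n K) : K[X] :=
  (M.map C - (X : K[X]) • F.map C).det

theorem pencilPoly_eq (M F : Matrix n n K) :
    pencilPoly M F = ((X : K[X]) • (-F).map C + M.map C).det := by
  rw [pencilPoly]
  congr 1
  ext i j
  simp
  ring

theorem eval_pencilPoly (M F : Matrix n n K) (z : K) :
    (pencilPoly M F).eval z = (M - z • F).det := by
  rw [pencilPoly, ← Polynomial.coe_evalRingHom, RingHom.map_det]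
  congr 1
  ext i j
  simp [mul_comm z]

/-- The constant coefficient is `det M` and the coefficient of degree `card n` is `± det F`. -/
theorem pencilPoly_ne_zero {M F : Matrix n n K} (h : ¬(M.det = 0 ∧ F.det = 0)) :
    pencilPoly M F ≠ 0 := by
  intro h0
  refine h ⟨?_, ?_⟩
  · simpa [eval_pencilPoly] using congrArg (eval 0) h0
  · have := congrArg (coeff · (Fintype.card n)) h0
    simpa [pencilPoly_eq, coeff_det_X_add_C_card, Matrix.det_neg] using this

theorem natDegree_pencilPoly {M F : Matrix n n K} (hF : F.det ≠ 0) :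
    (pencilPoly M F).natDegree = Fintype.card n := by
  rw [pencilPoly_eq]
  refine natDegree_eq_of_le_of_coeff_ne_zero (natDegree_det_X_add_C_le _ _) ?_
  rw [coeff_det_X_add_C_card, Matrix.det_neg]
  simp [hF]

theorem pencilPoly_mul_mul (U M F V : Matrix n n K) :
    pencilPoly (U * M * V) (U * F * V) = C (U.det * V.det) * pencilPoly M F := by
  have : (U * M * V).map C - (X : K[X]) • (U * F * V).map C
      = U.map C * (M.map C - (X : K[X]) • F.map C) * V.map C := by
    simp only [Matrix.map_mul, mul_sub, sub_mul, mul_smul_comm, smul_mul_assoc]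
  rw [pencilPoly, this, det_mul, det_mul, pencilPoly, C_mul, RingHom.map_det, RingHom.map_det]
  simp only [RingHom.mapMatrix_apply]
  ring

theorem pencilPoly_mul_mul_of_det_eq_one {U V : Matrix n n K} (hU : U.det = 1) (hV : V.det = 1)
    (M F : Matrix n n K) : pencilPoly (U * M * V) (U * F * V) = pencilPoly M F := by
  simp [pencilPoly_mul_mul, hU, hV]

theorem exists_det_eq_one_mul_mul_eq_diagonal (M : Matrix n n K) :
    ∃ (U V : Matrix n n K) (d : n → K), U.det = 1 ∧ V.det = 1 ∧ U * M * V = diagonal d := by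
  obtain ⟨L, L', d, h⟩ := Pivot.exists_list_transvec_mul_mul_list_transvec_eq_diagonal M
  exact ⟨_, _, d, TransvectionStruct.det_toMatrix_prod L,
    TransvectionStruct.det_toMatrix_prod L', h⟩

/-- A double root at `1` of `det (M - λ F)`, where `M - F` is diagonal with a vanishing entry,
forces `M - F` with the corresponding row replaced by that of `F` to be singular. -/
theorem det_updateRow_eq_zero_of_sq_dvd {M F : Matrix n n K} {d : n → K}
    (hd : M - F = diagonal d) {i : n} (hi : d i = 0) (h : (X - C 1) ^ 2 ∣ pencilPoly M F) :
    ((diagonal d).updateRow i (F i)).det = 0 := by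
  set P : Matrix n n K[X] := M.map C - (X : K[X]) • F.map C with hP
  -- Since `d i = 0`, row `i` of `M` equals row `i` of `F`, so row `i` of the pencil is `(1 - λ)`
  -- times it. Cancelling this factor and setting `λ = 1` gives the claim.
  have hrow : P = P.updateRow i ((-(X - C 1) : K[X]) • fun j => C (F i j)) := by
    ext a j
    rcases eq_or_ne a i with rfl | ha
    · have : M a j = F a j := by
        have := congrFun (congrFun hd a) j
        rw [Matrix.sub_apply, sub_eq_iff_eq_add, diagonal_apply] at this
        rw [this]; split_ifs <;> simp [hi]
      rw [updateRow_self, Pi.smul_apply, hP, Matrix.sub_apply, Matrix.smul_apply, map_apply,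
        map_apply, this, smul_eq_mul, smul_eq_mul, C_1, neg_sub, sub_mul, one_mul]
    · rw [updateRow_ne ha]
  have hdet : pencilPoly M F = (X - C 1) * -(P.updateRow i fun j => C (F i j)).det := by
    rw [pencilPoly, ← hP]
    conv_lhs => rw [hrow]
    rw [det_updateRow_smul, neg_mul, mul_neg]
  rw [hdet, pow_two, mul_dvd_mul_iff_left (X_sub_C_ne_zero 1), dvd_neg, dvd_iff_isRoot, IsRoot,
    ← Polynomial.coe_evalRingHom, RingHom.map_det] at h
  rw [← h]
  congr 1
  ext a j
  rcases eq_or_ne a i with rfl | ha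
  · simp
  · simp [updateRow_ne ha, hP, ← hd]

namespace TSylvesterInjective

variable {M F : Matrix n n K}

theorem not_sq_dvd_of_sub_eq_diagonal (h : TSylvesterInjective M F) {d : n → K}
    (hd : M - F = diagonal d) : ¬(X - C 1) ^ 2 ∣ pencilPoly M F := by
  intro hdvd
  have hker (i : n) (hi : d i = 0) : (M - F) *ᵥ Pi.single i 1 = 0 := by
    ext k
    rw [hd, mulVec_diagonal]
    rcases eq_or_ne k i with rfl | hk <;> simp [*]
  have hdet : (M - F).det = 0 := by
    have h1 : (X - C 1) ∣ pencilPoly M F := (dvd_pow_self _ two_ne_zero).trans hdvd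
    rw [dvd_iff_isRoot, IsRoot, eval_pencilPoly, one_smul] at h1
    exact h1
  obtain ⟨i, -, hi⟩ := Finset.prod_eq_zero_iff.mp ((det_diagonal (d := d)) ▸ hd ▸ hdet)
  have hne (k : n) (hk : k ≠ i) : d k ≠ 0 := fun h0 =>
    h.not_linearIndependent_of_sub_mulVec_eq_zero (hker k h0) (hker i hi)
      (linearIndependent_pair_single hk)
  -- The matrix with replaced row has only `F i i` as a possible zero pivot, so its singularity
  -- forces `F i i = 0`.
  have hFi : F i i = 0 := by
    obtain ⟨y, hy, hy0⟩ :=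
      exists_mulVec_eq_zero_iff.mpr (det_updateRow_eq_zero_of_sq_dvd hd hi hdvd)
    have hyk (k : n) (hk : k ≠ i) : y k = 0 := by
      have := congrFun hy0 k
      rw [mulVec, updateRow_ne hk] at this
      change (diagonal d *ᵥ y) k = 0 at this
      rw [mulVec_diagonal] at this
      exact (mul_eq_zero.mp this).resolve_left (hne k hk)
    have hyi : y i ≠ 0 := fun h0 => hy (funext fun k => by
      rcases eq_or_ne k i with rfl | hk
      · exact h0
      · exact hyk k hk)
    have := congrFun hy0 i
    rw [mulVec, updateRow_self, dotProduct, Finset.sum_eq_single i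
      (fun k _ hk => by rw [hyk k hk, mul_zero]) (by simp)] at this
    exact (mul_eq_zero.mp this).resolve_right hyi
  -- The vector solves `(M - F) y = F eᵢ` coordinatewise; at coordinate `i` both sides vanish. This
  -- is a forbidden Jordan chain.
  refine h.sub_mulVec_ne_of_sub_mulVec_eq_zero (x := Pi.single i 1) (by simp) (hker i hi)
    (fun k => (d k)⁻¹ * F k i) ?_
  ext k
  rw [hd, mulVec_diagonal, mulVec_single_one, col_apply]
  rcases eq_or_ne k i with rfl | hk
  · simp [hi, hFi]
  · rw [mul_inv_cancel_left₀ (hne k hk)]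

theorem not_sq_dvd (h : TSylvesterInjective M F) : ¬(X - C 1) ^ 2 ∣ pencilPoly M F := by
  obtain ⟨U, V, d, hU, hV, hd⟩ := exists_det_eq_one_mul_mul_eq_diagonal (M - F)
  have hU' : IsUnit U := (isUnit_iff_isUnit_det U).mpr (by simp [hU])
  have hV' : IsUnit V := (isUnit_iff_isUnit_det V).mpr (by simp [hV])
  rw [← pencilPoly_mul_mul_of_det_eq_one hU hV]
  exact (h.congr hU' hV').not_sq_dvd_of_sub_eq_diagonal (by rw [← hd, mul_sub, sub_mul])

theorem rootMultiplicity_one (h : TSylvesterInjective M F) (h1 : (M - F).det = 0) :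
    (pencilPoly M F).rootMultiplicity 1 = 1 := by
  have h0 := pencilPoly_ne_zero h.not_det_eq_zero_and
  refine le_antisymm (not_lt.mp fun h2 => h.not_sq_dvd ?_) ?_
  · exact (le_rootMultiplicity_iff h0).mp h2
  · exact (rootMultiplicity_pos h0).mpr (by simpa [IsRoot, eval_pencilPoly])

end TSylvesterInjective

end Pencil

/-! ### Sufficiency: the block carried by a nonzero solution -/

section Converse

theorem apply_eq_zero_of_diagonal_solution {K n : Type*} [Field K] {M F : Matrix n n K} {d : n → K}
    (h : ∀ i j, M i j * d j + F j i * d i = 0) {i j : n} (hi : ¬d i ≠ 0) (hj : d j ≠ 0) :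
    M i j = 0 ∧ F i j = 0 := by
  rw [not_not] at hi
  have h1 := h i j
  have h2 := h j i
  simp only [hi, mul_zero, add_zero, zero_add, mul_eq_zero, hj, or_false] at h1 h2
  exact ⟨h1, h2⟩

variable {K n : Type*} [Field K] [Fintype n] [DecidableEq n]

/-- With `D = diagonal d` invertible, the hypothesis says `A D = -D Bᵀ`, so `A - zB` is carried to
`(zA - B)ᵀ`. -/
theorem det_sub_smul_eq_det_smul_sub {A B : Matrix n n K} {d : n → K} (hd : ∀ i, d i ≠ 0)
    (h : ∀ i j, A i j * d j + B j i * d i = 0) (z : K) :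
    (A - z • B).det = (z • A - B).det := by
  have hm : (A - z • B) * diagonal d = diagonal d * (z • A - B)ᵀ := by
    ext i j
    simp only [mul_diagonal, diagonal_mul, Matrix.sub_apply, Matrix.smul_apply, transpose_apply,
      smul_eq_mul]
    linear_combination h i j - z * h j i
  have := congrArg det hm
  rw [det_mul, det_mul, det_transpose, mul_comm] at this
  exact mul_left_cancel₀ (by simp [det_diagonal, Finset.prod_ne_zero_iff, hd]) this

/-- The symmetry pairs each root with its inverse, so `hrec` leaves only the root `1`, with
multiplicity the full size. Size one is impossible: there `A + B = 0`, making `-1 ≠ 1` a root. -/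
theorem sq_dvd_pencilPoly [IsAlgClosed K] [NeZero (2 : K)] [Nonempty n] {A B : Matrix n n K}
    {d : n → K} (hd : ∀ i, d i ≠ 0) (h : ∀ i j, A i j * d j + B j i * d i = 0) (hB : B.det ≠ 0)
    (hrec : ∀ a b : K, a ≠ 1 → a * b = 1 → (A - a • B).det = 0 → (A - b • B).det ≠ 0) :
    (X - C 1) ^ 2 ∣ pencilPoly A B := by
  classical
  have hpal := det_sub_smul_eq_det_smul_sub hd h
  have hroot (a : K) (ha : (A - a • B).det = 0) : a = 1 := by
    by_contra hne
    have ha0 : a ≠ 0 := by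
      rintro rfl
      rw [hpal, zero_smul, zero_sub, det_neg] at ha
      exact hB (by simpa using ha)
    refine hrec a a⁻¹ hne (mul_inv_cancel₀ ha0) ha ?_
    have h1 := ha
    rw [hpal] at h1
    have h2 : a • A - B = a • (A - a⁻¹ • B) := by rw [smul_sub, smul_inv_smul₀ ha0]
    rw [h2, det_smul] at h1
    exact (mul_eq_zero.mp h1).resolve_left (pow_ne_zero _ ha0)
  have hp : pencilPoly A B ≠ 0 := pencilPoly_ne_zero fun h => hB h.2
  have hcard : (pencilPoly A B).roots.card = Fintype.card n := by
    rw [← natDegree_pencilPoly hB, splits_iff_card_roots.mp (IsAlgClosed.splits _)]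
  have hrep : (pencilPoly A B).roots = Multiset.replicate (Fintype.card n) 1 := by
    rw [Multiset.eq_replicate]
    refine ⟨hcard, fun a ha => hroot a ?_⟩
    rwa [mem_roots hp, IsRoot, eval_pencilPoly] at ha
  have htwo : 2 ≤ Fintype.card n := by
    by_contra hlt
    have h1 : Fintype.card n = 1 := by have := Fintype.card_pos (α := n); omega
    obtain ⟨i, hi⟩ := Fintype.card_eq_one_iff.mp h1
    have hii : A i i + B i i = 0 := by
      have := h i i
      rw [← add_mul] at this
      exact (mul_eq_zero.mp this).resolve_right (hd i)
    have : (-1 : K) = 1 := hroot (-1) (by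
      rw [det_eq_elem_of_card_eq_one h1 i]
      simpa using hii)
    exact two_ne_zero (α := K) (by linear_combination -this)
  refine (pow_dvd_pow _ ?_).trans (pow_rootMultiplicity_dvd (pencilPoly A B) 1)
  rwa [← count_roots, hrep, Multiset.count_replicate_self]

/-- Entries with row outside and column inside the support of `d` vanish, so the pencil is block
triangular. -/
theorem toSquareBlockProp_pencilPoly_dvd [DecidableEq K] {M F : Matrix n n K} {d : n → K}
    (h : ∀ i j, M i j * d j + F j i * d i = 0) :
    pencilPoly (M.toSquareBlockProp (d · ≠ 0)) (F.toSquareBlockProp (d · ≠ 0)) ∣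
      pencilPoly M F := by
  refine ⟨_, twoBlockTriangular_det _ (d · ≠ 0) fun i hi j hj => ?_⟩
  simp [apply_eq_zero_of_diagonal_solution h hi hj]

theorem tSylvesterInjective_of_spectrum [IsAlgClosed K] [NeZero (2 : K)] {M F : Matrix n n K}
    (h0 : ¬(M.det = 0 ∧ F.det = 0))
    (hrec : ∀ a b : K, a ≠ 1 → a * b = 1 → (M - a • F).det = 0 → (M - b • F).det ≠ 0)
    (hsq : ¬(X - C 1) ^ 2 ∣ pencilPoly M F) : TSylvesterInjective M F := by
  classical
  intro Y hY
  obtain ⟨U, V, d, hU, hV, hd⟩ := exists_det_eq_one_mul_mul_eq_diagonal Y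
  have hUu : IsUnit U.det := by simp [hU]
  have hVu : IsUnit V.det := by simp [hV]
  by_contra hY0
  have hd0 : ∃ i, d i ≠ 0 := by
    by_contra! hall
    have hz : U * Y * V = 0 := by simp [hd, show d = 0 from funext hall]
    rw [((isUnit_iff_isUnit_det V).mpr hVu).mul_left_eq_zero,
      ((isUnit_iff_isUnit_det U).mpr hUu).mul_right_eq_zero] at hz
    exact hY0 hz
  set M' := Vᵀ * M * U⁻¹ with hM'
  set F' := Vᵀ * F * U⁻¹ with hF'
  have hYd : U⁻¹ * diagonal d = Y * V := by
    rw [← hd, Matrix.mul_assoc, nonsing_inv_mul_cancel_left _ _ hUu]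
  have hentry (i j : n) : M' i j * d j + F' j i * d i = 0 := by
    have hzero : M' * diagonal d + (F' * diagonal d)ᵀ = 0 := by
      have : Vᵀ * (M * Y + (F * Y)ᵀ) * V = 0 := by rw [hY]; simp
      rw [← this, hM', hF', Matrix.mul_assoc _ U⁻¹, Matrix.mul_assoc _ U⁻¹, hYd, mul_add, add_mul]
      simp only [transpose_mul, transpose_transpose, Matrix.mul_assoc]
    simpa [mul_comm] using congrFun (congrFun hzero i) j
  have hV' : Vᵀ.det = 1 := by rw [det_transpose, hV]
  have hU' : U⁻¹.det = 1 := by rw [det_nonsing_inv, hU, Ring.inverse_one]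
  have hpoly : pencilPoly M' F' = pencilPoly M F := pencilPoly_mul_mul_of_det_eq_one hV' hU' M F
  have hdvd := toSquareBlockProp_pencilPoly_dvd hentry
  rw [hpoly] at hdvd
  have hdet (z : K) (hz : (M'.toSquareBlockProp (d · ≠ 0) -
      z • F'.toSquareBlockProp (d · ≠ 0)).det = 0) : (M - z • F).det = 0 := by
    rw [← eval_pencilPoly] at hz ⊢
    exact eval_eq_zero_of_dvd_of_eval_eq_zero hdvd hz
  have hrest (i j : {i // d i ≠ 0}) : M'.toSquareBlockProp (d · ≠ 0) i j * d j +
      F'.toSquareBlockProp (d · ≠ 0) j i * d i = 0 := hentry i j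
  have : Nonempty {i // d i ≠ 0} := nonempty_subtype.mpr hd0
  refine hsq ((sq_dvd_pencilPoly (d := fun i : {i // d i ≠ 0} => d i) (fun i => i.2) hrest ?_
    fun a b ha hab h1 h2 => hrec a b ha hab (hdet a h1) (hdet b h2)).trans hdvd)
  -- If the block of `F'` were singular, the symmetry at `z = 0` would make that of `M'` singular
  -- too, hence both `M` and `F`.
  intro hF
  refine h0 ⟨?_, ?_⟩
  · have := hdet 0 (by
      rw [det_sub_smul_eq_det_smul_sub (d := fun i : {i // d i ≠ 0} => d i) (fun i => i.2) hrest,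
        zero_smul, zero_sub, det_neg, hF, mul_zero])
    simpa using this
  · have : F'.det = 0 := by
      rw [twoBlockTriangular_det _ (d · ≠ 0)
        fun i hi j hj => (apply_eq_zero_of_diagonal_solution hentry hi hj).2, hF, zero_mul]
    simpa [hF', hV', hU'] using this

theorem tSylvesterInjective_iff [IsAlgClosed K] [NeZero (2 : K)] (M F : Matrix n n K) :
    TSylvesterInjective M F ↔ ¬(M.det = 0 ∧ F.det = 0) ∧
      (∀ a b : K, a ≠ 1 → a * b = 1 → (M - a • F).det = 0 → (M - b • F).det ≠ 0) ∧
      ((M - F).det = 0 → (pencilPoly M F).rootMultiplicity 1 = 1) := by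
  refine ⟨fun h => ⟨h.not_det_eq_zero_and, fun a b => h.not_reciprocal_eigenvalues,
    h.rootMultiplicity_one⟩, fun ⟨h0, hrec, h1⟩ => tSylvesterInjective_of_spectrum h0 hrec ?_⟩
  intro hsq
  have hle := (le_rootMultiplicity_iff (pencilPoly_ne_zero h0)).mpr hsq
  have hdet : (M - F).det = 0 := by
    have : (X - C 1) ∣ pencilPoly M F := (dvd_pow_self _ two_ne_zero).trans hsq
    rwa [dvd_iff_isRoot, IsRoot, eval_pencilPoly, one_smul] at this
  have := h1 hdet
  omega

end Converse

/-! ### Descent along a field extension -/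

section BaseChange

variable {K L n : Type*} [Field K] [Field L] [Algebra K L]

theorem map_linearMap_mul [Fintype n] (f : L →ₗ[K] K) (M : Matrix n n K) (X : Matrix n n L) :
    (M.map (algebraMap K L) * X).map f = M * X.map f := by
  ext i j
  simp [mul_apply, map_sum, ← Algebra.smul_def]

theorem map_linearMap_mul' [Fintype n] (f : L →ₗ[K] K) (M : Matrix n n K) (X : Matrix n n L) :
    (X * M.map (algebraMap K L)).map f = X.map f * M := by
  ext i j
  simp only [map_apply, mul_apply, map_sum]
  refine Finset.sum_congr rfl fun k _ => ?_
  rw [mul_comm, ← Algebra.smul_def, map_smul, smul_eq_mul, mul_comm]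

/-- `K`-linear functionals on `L` separate points; applied entrywise, they send solutions over `L`
to solutions over `K`. -/
theorem eq_zero_of_forall_map_linearMap {X : Matrix n n L}
    (h : ∀ f : L →ₗ[K] K, X.map f = 0) : X = 0 := by
  ext i j
  exact (Module.forall_dual_apply_eq_zero_iff K (X i j)).mp fun f => congrFun (congrFun (h f) i) j

theorem eq_zero_of_map_algebraMap_eq_zero {X : Matrix n n K}
    (h : X.map (algebraMap K L) = 0) : X = 0 := by
  ext i j
  exact (map_eq_zero (algebraMap K L)).mp (congrFun (congrFun h i) j)

theorem sylvesterInjective_map_iff [Fintype n] (M N : Matrix n n K) :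
    SylvesterInjective (M.map (algebraMap K L)) (N.map (algebraMap K L)) ↔
      SylvesterInjective M N := by
  refine ⟨fun h X hX => eq_zero_of_map_algebraMap_eq_zero (h _ ?_), fun h X hX =>
    eq_zero_of_forall_map_linearMap (K := K) fun f => h _ ?_⟩
  · rw [← Matrix.map_mul, ← Matrix.map_mul, ← Matrix.map_sub _ (map_sub _), hX,
      Matrix.map_zero _ (map_zero _)]
  · rw [← map_linearMap_mul, ← map_linearMap_mul', ← Matrix.map_sub _ (map_sub f), hX,
      Matrix.map_zero _ (map_zero f)]

theorem tSylvesterInjective_map_iff [Fintype n] (M F : Matrix n n K) :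
    TSylvesterInjective (M.map (algebraMap K L)) (F.map (algebraMap K L)) ↔
      TSylvesterInjective M F := by
  refine ⟨fun h X hX => eq_zero_of_map_algebraMap_eq_zero (h _ ?_), fun h X hX =>
    eq_zero_of_forall_map_linearMap (K := K) fun f => h _ ?_⟩
  · rw [← Matrix.map_mul, ← Matrix.map_mul, ← transpose_map, ← Matrix.map_add _ (map_add _), hX,
      Matrix.map_zero _ (map_zero _)]
  · rw [← map_linearMap_mul, ← map_linearMap_mul, ← transpose_map, ← Matrix.map_add _ (map_add f), hX,
      Matrix.map_zero _ (map_zero f)]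

theorem existsUnique_apply_eq_iff {V : Type*} [AddCommGroup V] [Module K V]
    [FiniteDimensional K V] (f : V →ₗ[K] V) (c : V) :
    (∃! x, f x = c) ↔ ∀ x, f x = 0 → x = 0 := by
  constructor
  · rintro ⟨x, hx, huniq⟩ y hy
    have := huniq (x + y) (by simp only [map_add, hx, hy, add_zero])
    simpa using this
  · intro h
    have hinj : Function.Injective f := (injective_iff_map_eq_zero f).mpr h
    obtain ⟨x, hx⟩ := LinearMap.injective_iff_surjective.mp hinj c
    exact ⟨x, hx, fun y hy => hinj (hy.trans hx.symm)⟩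

end BaseChange

/-! ### Reduction of the original equations and spectra -/

section RCLike

variable {𝕜 : Type*} [RCLike 𝕜] {m : ℕ}

/-- The canonical embedding of `ℝ` or `ℂ` into `ℂ` as a ring homomorphism. -/
noncomputable def toComplexHom (𝕜 : Type*) [RCLike 𝕜] : 𝕜 →+* ℂ where
  toFun := RCLike.map 𝕜 ℂ
  map_one' := by simp
  map_zero' := map_zero _
  map_add' := map_add _
  map_mul' x y := by
    apply Complex.ext <;> simp [RCLike.mul_re, RCLike.mul_im]

theorem sylvesterInjective_toComplex_iff (M N : Matrix (Fin m) (Fin m) 𝕜) :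
    SylvesterInjective (toComplex M) (toComplex N) ↔ SylvesterInjective M N :=
  letI := (toComplexHom 𝕜).toAlgebra
  sylvesterInjective_map_iff (L := ℂ) M N

theorem tSylvesterInjective_toComplex_iff (M F : Matrix (Fin m) (Fin m) 𝕜) :
    TSylvesterInjective (toComplex M) (toComplex F) ↔ TSylvesterInjective M F :=
  letI := (toComplexHom 𝕜).toAlgebra
  tSylvesterInjective_map_iff (L := ℂ) M F

theorem permMat_transpose_mul_self (σ : Equiv.Perm (Fin m)) :
    (permMat 𝕜 σ)ᵀ * permMat 𝕜 σ = 1 := by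
  rw [Matrix.transpose_permMatrix, ← Matrix.permMatrix_mul]
  simp

theorem eq_zero_iff_permMat_transpose_mul_eq_zero (σ : Equiv.Perm (Fin m))
    (Y : Matrix (Fin m) (Fin m) 𝕜) : Y = 0 ↔ (permMat 𝕜 σ)ᵀ * Y = 0 := by
  refine ⟨fun h => by rw [h, mul_zero], fun h => ?_⟩
  have h1 := mul_eq_one_comm.mp (permMat_transpose_mul_self (𝕜 := 𝕜) σ)
  rw [← Matrix.one_mul Y, ← h1, Matrix.mul_assoc, h, mul_zero]

theorem uniquelySolvable_opP_iff (σ : Equiv.Perm (Fin m)) (A B C : Matrix (Fin m) (Fin m) 𝕜) :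
    UniquelySolvable (opP σ) A B C ↔
      SylvesterInjective ((permMat 𝕜 σ)ᵀ * A) (-((permMat 𝕜 σ)ᵀ * B)) := by
  let f : Matrix (Fin m) (Fin m) 𝕜 →ₗ[𝕜] Matrix (Fin m) (Fin m) 𝕜 :=
    { toFun := fun X => A * X + opP σ X * B
      map_add' := fun X Y => by simp only [opP, mul_add, add_mul]; abel
      map_smul' := fun c X => by simp [opP] }
  refine (existsUnique_apply_eq_iff f C).trans (forall_congr' fun X => ?_)
  have : (permMat 𝕜 σ)ᵀ * f X =
      (permMat 𝕜 σ)ᵀ * A * X - X * -((permMat 𝕜 σ)ᵀ * B) := by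
    change (permMat 𝕜 σ)ᵀ * (A * X + permMat 𝕜 σ * X * (permMat 𝕜 σ)ᵀ * B) = _
    rw [mul_add, mul_neg, sub_neg_eq_add, ← Matrix.mul_assoc, ← Matrix.mul_assoc,
      ← Matrix.mul_assoc, ← Matrix.mul_assoc, permMat_transpose_mul_self, Matrix.one_mul,
      Matrix.mul_assoc X]
  rw [eq_zero_iff_permMat_transpose_mul_eq_zero σ (f X), this]

theorem uniquelySolvable_opR_iff (σ : Equiv.Perm (Fin m)) (A B C : Matrix (Fin m) (Fin m) 𝕜) :
    UniquelySolvable (opR σ) A B C ↔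
      TSylvesterInjective ((permMat 𝕜 σ)ᵀ * A) (Bᵀ * permMat 𝕜 σ) := by
  let f : Matrix (Fin m) (Fin m) 𝕜 →ₗ[𝕜] Matrix (Fin m) (Fin m) 𝕜 :=
    { toFun := fun X => A * X + opR σ X * B
      map_add' := fun X Y => by simp only [opR, transpose_add, mul_add, add_mul]; abel
      map_smul' := fun c X => by simp [opR] }
  refine (existsUnique_apply_eq_iff f C).trans (forall_congr' fun X => ?_)
  have : (permMat 𝕜 σ)ᵀ * f X =
      (permMat 𝕜 σ)ᵀ * A * X + (Bᵀ * permMat 𝕜 σ * X)ᵀ := by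
    change (permMat 𝕜 σ)ᵀ * (A * X + permMat 𝕜 σ * Xᵀ * (permMat 𝕜 σ)ᵀ * B) = _
    rw [mul_add, ← Matrix.mul_assoc, ← Matrix.mul_assoc, ← Matrix.mul_assoc, ← Matrix.mul_assoc,
      permMat_transpose_mul_self, Matrix.one_mul, transpose_mul, transpose_mul,
      transpose_transpose, Matrix.mul_assoc Xᵀ]
  rw [eq_zero_iff_permMat_transpose_mul_eq_zero σ (f X), this]

theorem coe_mem_pencilSpectrum_iff {E F : Matrix (Fin m) (Fin m) 𝕜} {z : ℂ} :
    (z : OnePoint ℂ) ∈ pencilSpectrum E F ↔ (toComplex E - z • toComplex F).det = 0 := by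
  simp [pencilSpectrum]

theorem infty_mem_pencilSpectrum_iff {E F : Matrix (Fin m) (Fin m) 𝕜} :
    OnePoint.infty ∈ pencilSpectrum E F ↔ (toComplex F).det = 0 := by
  simp [pencilSpectrum]

/-- The pair `0, ∞` accounts for the first clause, finite pairs for the second; there `b ≠ 1`
follows from `a ≠ 1`. -/
theorem forall_not_areReciprocal_iff (E F : Matrix (Fin m) (Fin m) 𝕜) :
    (∀ w₁ ∈ pencilSpectrum E F \ {((1 : ℂ) : OnePoint ℂ)},
      ∀ w₂ ∈ pencilSpectrum E F \ {((1 : ℂ) : OnePoint ℂ)}, ¬AreReciprocal w₁ w₂) ↔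
      ¬((toComplex E).det = 0 ∧ (toComplex F).det = 0) ∧
      ∀ a b : ℂ, a ≠ 1 → a * b = 1 → (toComplex E - a • toComplex F).det = 0 →
        (toComplex E - b • toComplex F).det ≠ 0 := by
  have hzero : ((0 : ℂ) : OnePoint ℂ) ∈ pencilSpectrum E F ↔ (toComplex E).det = 0 := by
    rw [coe_mem_pencilSpectrum_iff, zero_smul, sub_zero]
  constructor
  · refine fun h => ⟨fun ⟨hE, hF⟩ => ?_, fun a b ha hab h1 h2 => ?_⟩
    · refine h _ ⟨hzero.mpr hE, ?_⟩ _ ⟨infty_mem_pencilSpectrum_iff.mpr hF, ?_⟩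
        (Or.inr (Or.inl ⟨rfl, rfl⟩))
      · simp
      · exact OnePoint.infty_ne_coe _
    · have hb : b ≠ 1 := by
        rintro rfl
        exact ha (by simpa using hab)
      refine h a ⟨coe_mem_pencilSpectrum_iff.mpr h1, ?_⟩ b ⟨coe_mem_pencilSpectrum_iff.mpr h2, ?_⟩
        (Or.inl ⟨a, b, rfl, rfl, hab⟩)
      · simpa using ha
      · simpa using hb
  · rintro ⟨h0, h⟩ w₁ ⟨h1, h1'⟩ w₂ ⟨h2, -⟩ (⟨a, b, rfl, rfl, hab⟩ | ⟨rfl, rfl⟩ | ⟨rfl, rfl⟩)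
    · exact h a b (by simpa using h1') hab (coe_mem_pencilSpectrum_iff.mp h1)
        (coe_mem_pencilSpectrum_iff.mp h2)
    · exact h0 ⟨hzero.mp h1, infty_mem_pencilSpectrum_iff.mp h2⟩
    · exact h0 ⟨hzero.mp h2, infty_mem_pencilSpectrum_iff.mp h1⟩

end RCLike

end SylvesterLike

theorem mainTheorem4 {𝕜 : Type*} [RCLike 𝕜] (m : ℕ) (σ : Equiv.Perm (Fin m))
    (A B C : Matrix (Fin m) (Fin m) 𝕜) :
    (SylvesterLike.UniquelySolvable (SylvesterLike.opP σ) A B C ↔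
      SylvesterLike.eigenvalues ((SylvesterLike.permMat 𝕜 σ)ᵀ * A) ∩
        SylvesterLike.eigenvalues (-((SylvesterLike.permMat 𝕜 σ)ᵀ * B)) = ∅) ∧
    (SylvesterLike.UniquelySolvable (SylvesterLike.opR σ) A B C ↔
      (∀ w₁ ∈ SylvesterLike.pencilSpectrum ((SylvesterLike.permMat 𝕜 σ)ᵀ * A)
            (Bᵀ * SylvesterLike.permMat 𝕜 σ) \ {((1 : ℂ) : OnePoint ℂ)},
        ∀ w₂ ∈ SylvesterLike.pencilSpectrum ((SylvesterLike.permMat 𝕜 σ)ᵀ * A)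
            (Bᵀ * SylvesterLike.permMat 𝕜 σ) \ {((1 : ℂ) : OnePoint ℂ)},
          ¬ SylvesterLike.AreReciprocal w₁ w₂) ∧
      (((1 : ℂ) : OnePoint ℂ) ∈ SylvesterLike.pencilSpectrum ((SylvesterLike.permMat 𝕜 σ)ᵀ * A)
            (Bᵀ * SylvesterLike.permMat 𝕜 σ) →
        SylvesterLike.IsSimpleEigenvalue ((SylvesterLike.permMat 𝕜 σ)ᵀ * A)
            (Bᵀ * SylvesterLike.permMat 𝕜 σ) 1)) := by
  constructor
  · rw [SylvesterLike.uniquelySolvable_opP_iff, ← SylvesterLike.sylvesterInjective_toComplex_iff,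
      SylvesterLike.sylvesterInjective_iff]
    rfl
  · rw [SylvesterLike.uniquelySolvable_opR_iff, ← SylvesterLike.tSylvesterInjective_toComplex_iff,
      SylvesterLike.tSylvesterInjective_iff, SylvesterLike.forall_not_areReciprocal_iff, and_assoc,
      SylvesterLike.coe_mem_pencilSpectrum_iff, one_smul]
    rfl
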